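/- **Setting.** In an online maximization problem with binary predictions, an instance is a triple $I=(x,\hat x,r)$, where $r=(r_1,\dots,r_n)$ is a finite request sequence and $x,\hat x\in\{0,1\}^n$. A deterministic online algorithm $\mathrm{Alg}$ answers each request $r_i$ with a bit $y_i\in\{0,1\}$ that depends only on $r_1,\hat x_1,\dots,r_i,\hat x_i$; the answer $y_i=0$ means that $r_i$ is accepted. The profit $\mathrm{Alg}(I)$ is $\sum_{i=1}^n(1-y_i)$ if the accepted requests form a feasible solution, and $-\infty$ otherwise. $\mathrm{Opt}(I)$ is the maximum profit over all strings in $\{0,1\}^n$. The string $x$ is required to encode an optimal solution, whereas $\hat x$ is arbitrary. Put $$\mu_0(I)=\sum_{i=1}^n x_i(1-\hat x_i),\qquad \mu_1(I)=\sum_{i=1}^n(1-x_i)\hat x_i .$$ For $\alpha,\beta,\gamma$ mapping instances to $[0,\infty)$ (constants being a special case), $\mathrm{Alg}$ is $(\alpha,\beta,\gamma)$-competitive with respect to $(\mu_0,\mu_1)$ if there is a constant $\kappa\in\mathbb R$ such that for all instances $I$ $$\mathrm{Opt}(I)\le \alpha(I)\,\mathrm{Alg}(I)+\beta(I)\,\mu_0(I)+\gamma(I)\,\mu_1(I)+\kappa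 .$$ **Problems.** Let $t\in\mathbb Z^+\cup\{\infty\}$. - $\mathrm{BDIS}_t$: the requests reveal the vertices of a finite graph one by one, each together with its edges to previously revealed vertices; the maximum degree is at most $t$; feasible solutions are independent sets. - $\mathrm{Sch}_t$: the requests are nonempty bounded open intervals of $\mathbb{R}$; each overlaps (intersects) at most $t$ other requested intervals; feasible solutions are collections of pairwise non-overlapping intervals. - $\mathrm{SP}_t$: the requests are finite sets; each intersects at most $t$ other requested sets; feasible solutions are collections of pairwise disjoint sets. - $\mathrm{Cli}_t$: the vertices of a finite graph $G=(V,E)$ are revealed one by one as for $\mathrm{BDIS}_t$; the minimum degree $\delta(G)$ satisfies $|V|-1-t\le\delta(G)$, that is, each vertex has at most $t$ non-neighbours other than itself; feasible solutions are cliques. **Corollary.** Let $t\in\mathbb Z^+\cup\{\infty\}$, let $P\in\{\mathrm{BDIS}_t,\mathrm{Sch}_t,\mathrm{SP}_t,\mathrm{Cli}_t\}$, and let $\mathrm{Alg}$ be a deterministic $(\alpha,\beta,\gamma)$-competitive online algorithm for $P$ with respect to $(\mu_0,\mu_1)$. Then 1. $\alpha+\beta\ge t$, 2. $\alpha+(t-1)\gamma\ge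 t$, and 3. if $\beta=\gamma=0$, then $\alpha\ge t$. For constants $\alpha,\beta,\gamma$ these are inequalities between extended nonnegative numbers, with $\infty-1=\infty$ and $\infty\cdot 0=0$. For instance-dependent $\alpha,\beta,\gamma$, the left-hand sides are understood as suprema over all instances $I$ of $P$, i.e. $\sup_I(\alpha(I)+\beta(I))\ge t$, $\sup_I(\alpha(I)+(t-1)\gamma(I))\ge t$, and $\sup_I\alpha(I)\ge t$. -/

import Mathlib

open scoped NNReal ENNReal

noncomputable section

/-- An online maximization problem with binary predictions whose profit is the number of accepted
requests (answer `0`, i.e. `false`) if the set of accepted requests is feasible, and `-∞` otherwise.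
`Valid` singles out the request sequences that may occur; `Feasible r S` says that accepting
exactly the requests with index in `S` is a feasible solution for the request sequence `r`. -/
structure OnlineMaxProblem where
  Request : Type
  Valid : ∀ {n : ℕ}, (Fin n → Request) → Prop
  Feasible : ∀ {n : ℕ}, (Fin n → Request) → Set (Fin n) → Prop

namespace OnlineMaxProblem

variable (P : OnlineMaxProblem)

open Classical in
/-- The profit of the output string `y` on the request sequence `r`; bit `0` is `false`, and
`y i = false` means that request `i` is accepted. -/
def profit {n : ℕ} (r : Fin n → P.Request) (y : Fin n → Bool) : EReal :=
  if P.Feasible r {i | y i = false} then ((∑ i, (1 - ((y i).toNat : ℝ)) : ℝ) : EReal) else ⊥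

/-- The profit of an optimal (offline) solution. -/
def optProfit {n : ℕ} (r : Fin n → P.Request) : EReal :=
  ⨆ y : Fin n → Bool, P.profit r y

/-- An instance `(x, x̂, r)`: a valid finite request sequence `r`, the string `x` of true bits, which
encodes an optimal solution, and the string `xhat` of predicted bits, which is arbitrary. -/
structure Instance where
  n : ℕ
  x : Fin n → Bool
  xhat : Fin n → Bool
  r : Fin n → P.Request
  valid : P.Valid r
  optimal : P.profit r x = P.optProfit r

/-- A deterministic online algorithm: its answer to request number `i` (counted from `0`) is a
function of the first `i + 1` requests and their predictions. -/
def Algorithm : Type :=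
  (i : ℕ) → (Fin (i + 1) → P.Request × Bool) → Bool

variable {P}

/-- The string of answers of an algorithm on an instance. -/
def Algorithm.output (A : P.Algorithm) (I : P.Instance) : Fin I.n → Bool :=
  fun i => A i fun j => (I.r (Fin.castLE i.isLt j), I.xhat (Fin.castLE i.isLt j))

/-- The profit of an algorithm on an instance. -/
def Algorithm.profit (A : P.Algorithm) (I : P.Instance) : EReal :=
  P.profit I.r (A.output I)

/-- The profit of an optimal solution of an instance. -/
def Instance.opt (I : P.Instance) : EReal :=
  P.optProfit I.r

/-- The number of requests with true bit `1` and predicted bit `0`. -/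
def mu0 (I : P.Instance) : ℝ≥0 :=
  ∑ i, ((I.x i).toNat : ℝ≥0) * (1 - ((I.xhat i).toNat : ℝ≥0))

/-- The number of requests with true bit `0` and predicted bit `1`. -/
def mu1 (I : P.Instance) : ℝ≥0 :=
  ∑ i, (1 - ((I.x i).toNat : ℝ≥0)) * ((I.xhat i).toNat : ℝ≥0)

/-- `(α, β, γ)`-competitiveness with respect to the error measures `(η0, η1)`. As in the usual
definition, `α`, `β`, `γ` may depend on the instance; the additive constant `κ` may not. -/
def Algorithm.IsCompetitive (A : P.Algorithm) (α β γ η0 η1 : P.Instance → ℝ≥0) : Prop :=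
  ∃ κ : ℝ, ∀ I : P.Instance,
    I.opt ≤ ((α I : ℝ) : EReal) * A.profit I
      + (((β I : ℝ) * η0 I + (γ I : ℝ) * η1 I + κ : ℝ) : EReal)

end OnlineMaxProblem

/-! ### Vertex arrival -/

/-- A request in the vertex-arrival model: a vertex name together with the names of the previously
revealed vertices that it is adjacent to. -/
structure VertexRequest where
  vertex : ℕ
  nbrs : Finset ℕ

/-- The vertices are distinct, and every request only lists previously revealed neighbours. -/
def IsVertexArrival {n : ℕ} (r : Fin n → VertexRequest) : Prop :=
  Function.Injective (fun i => (r i).vertex) ∧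
    ∀ j, ∀ v ∈ (r j).nbrs, ∃ i, i < j ∧ (r i).vertex = v

/-- The underlying graph, the `i`-th revealed vertex being represented by its index `i`. -/
def arrivalGraph {n : ℕ} (r : Fin n → VertexRequest) : SimpleGraph (Fin n) :=
  SimpleGraph.fromRel fun i j => (r i).vertex ∈ (r j).nbrs

/-- Online `t`-Bounded Degree Independent Set: graphs of maximum degree at most `t`. -/
def BDIS (t : ℕ∞) : OnlineMaxProblem where
  Request := VertexRequest
  Valid r := IsVertexArrival r ∧ ∀ i, ((arrivalGraph r).neighborSet i).encard ≤ t
  Feasible r S := (arrivalGraph r).IsIndepSet S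

/-- Online `t`-Bounded Clique: graphs `G` with `|V| - 1 - t ≤ δ(G)`, i.e. every vertex has at most
`t` non-neighbours other than itself. -/
def Cli (t : ℕ∞) : OnlineMaxProblem where
  Request := VertexRequest
  Valid {n} r := IsVertexArrival r ∧
    ∀ i, (n : ℕ∞) ≤ ((arrivalGraph r).neighborSet i).encard + t + 1
  Feasible r S := (arrivalGraph r).IsClique S

/-! ### Interval scheduling and set packing -/

/-- A nonempty bounded open interval of real numbers. -/
structure OpenInterval where
  left : ℝ
  right : ℝ
  left_lt_right : left < right

/-- The points of an open interval. -/
def OpenInterval.toSet (s : OpenInterval) : Set ℝ := Set.Ioo s.left s.right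

/-- Online `t`-Bounded Overlap Interval Scheduling: every requested interval overlaps at most `t`
other requested intervals. -/
def Sch (t : ℕ∞) : OnlineMaxProblem where
  Request := OpenInterval
  Valid r := ∀ i, {j | j ≠ i ∧ ((r i).toSet ∩ (r j).toSet).Nonempty}.encard ≤ t
  Feasible r S := ∀ i ∈ S, ∀ j ∈ S, i ≠ j → ¬ ((r i).toSet ∩ (r j).toSet).Nonempty

/-- Online `t`-Bounded Set-Arrival Set Packing: every requested finite set intersects at most `t`
other requested sets. -/
def SP (t : ℕ∞) : OnlineMaxProblem where
  Request := Finset ℕ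
  Valid r := ∀ i, {j | j ≠ i ∧ (r i ∩ r j).Nonempty}.encard ≤ t
  Feasible r S := ∀ i ∈ S, ∀ j ∈ S, i ≠ j → Disjoint (r i) (r j)

end

/-! An adversary argument that works for all four problems at once. Fix a finite `T ≤ t`. The
adversary presents an isolated request with prediction `b`. If it is accepted, `T` leaves
conflicting with it alone follow: the optimum takes the leaves, and the player gains 1 or becomes
infeasible. If it is rejected, the optimum takes it. A round stops at the first acceptance, or after
`T - 1` rejections and one free request with prediction 0.

So each round adds at least `T` to the optimum and at most 1 to the player (`Reachable.round`). For
`b = 0` it costs at most one `mu0` error, on an accepted centre; for `b = 1` at most `T - 1` `mu1`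
errors, on rejected requests. All other predictions are correct. After `M` rounds, competitiveness
gives `T * M ≤ s * M + κ`, where `s` bounds the relevant combination of `α`, `β`, `γ`; large `M`
forces `s ≥ T`.

Only star forests occur, and `EncodesStarForests` realises them in each problem by requests that
depend only on a position and its parent. Hence a centre looks isolated until its leaves arrive. -/

/-- The parent function `p` describes a forest of stars: every leaf has a centre among the
`T` preceding positions. -/
def IsStarForest (T : ℕ) (p : ℕ → Option ℕ) : Prop :=
  ∀ i j, p i = some j → j < i ∧ i ≤ j + T ∧ p j = none

/-- A deterministic online player: the answer at position `i` depends only on the parents and the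
predictions at positions up to `i`. -/
def IsOnline (B : (ℕ → Option ℕ) → (ℕ → Bool) → ℕ → Bool) : Prop :=
  ∀ i p p' q q', (∀ j ≤ i, p j = p' j) → (∀ j ≤ i, q j = q' j) → B p q i = B p' q' i

/-- A play of length `n` against the online player `B` on a star forest `p`, with predictions `q`
and optimal solution `x`. The player accepts at most `a` centres, the optimum is at least `o`, and
the two prediction errors are at most `m₀` and `m₁`. -/
structure IsPlay (B : (ℕ → Option ℕ) → (ℕ → Bool) → ℕ → Bool) (T a o m₀ m₁ n : ℕ)
    (p : ℕ → Option ℕ) (q x : ℕ → Bool) : Prop where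
  beyond : ∀ i, n ≤ i → q i = false ∧ x i = false
  leaf : ∀ i j, p i = some j → j < i ∧ i ≤ j + T ∧ i < n ∧ p j = none ∧ x i = false ∧
    x j = true ∧ B p q j = false
  accepted : Nat.count (fun i => p i = none ∧ B p q i = false) n ≤ a
  le_count : o ≤ Nat.count (fun i => x i = false) n
  optimal : ∀ y : ℕ → Bool, (∀ i < n, ∀ j, p i = some j → y i = false → y j = true) →
    Nat.count (fun i => y i = false) n ≤ Nat.count (fun i => x i = false) n
  error₀ : Nat.count (fun i => x i = true ∧ q i = false) n ≤ m₀
  error₁ : Nat.count (fun i => x i = false ∧ q i = true) n ≤ m₁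

/-- Some play has the given bounds. -/
def Reachable (B : (ℕ → Option ℕ) → (ℕ → Bool) → ℕ → Bool) (T a o m₀ m₁ : ℕ) : Prop :=
  ∃ n p q x, IsPlay B T a o m₀ m₁ n p q x

theorem Nat.count_congr_of_lt {P Q : ℕ → Prop} [DecidablePred P] [DecidablePred Q] {n : ℕ}
    (h : ∀ i < n, (P i ↔ Q i)) : Nat.count P n = Nat.count Q n := by
  rw [Nat.count_eq_card_filter_range, Nat.count_eq_card_filter_range]
  congr 1
  exact Finset.filter_congr fun i hi => h i (Finset.mem_range.1 hi)

/-- Bookkeeping for one appended star: the old positions, the centre `n`, and `T` leaves that all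
behave alike. -/
theorem Nat.count_add_one_add {P Q : ℕ → Prop} [DecidablePred P] [DecidablePred Q] {n T : ℕ}
    (R : Prop) [Decidable R] (hQ : ∀ i < n, (P i ↔ Q i)) (hR : ∀ k < T, (P (n + (1 + k)) ↔ R)) :
    Nat.count P (n + (1 + T)) =
      Nat.count Q n + (if P n then 1 else 0) + (if R then T else 0) := by
  rw [← add_assoc, Nat.count_add, Nat.count_succ, Nat.count_congr_of_lt hQ,
    Nat.count_congr_of_lt (n := T) (Q := fun _ => R) (fun k hk => by rw [add_assoc]; exact hR k hk)]
  by_cases h : R <;> simp [h]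

/-! ### The adversary's rounds -/

section Play

variable {B : (ℕ → Option ℕ) → (ℕ → Bool) → ℕ → Bool} {T a o m₀ m₁ : ℕ}

theorem Reachable.mono {a' o' m₀' m₁' : ℕ} (h : Reachable B T a o m₀ m₁) (ha : a ≤ a')
    (ho : o' ≤ o) (h₀ : m₀ ≤ m₀') (h₁ : m₁ ≤ m₁') : Reachable B T a' o' m₀' m₁' := by
  obtain ⟨n, p, q, x, h⟩ := h
  exact ⟨n, p, q, x, h.beyond, h.leaf, h.accepted.trans ha, ho.trans h.le_count, h.optimal,
    h.error₀.trans h₀, h.error₁.trans h₁⟩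

theorem reachable_zero : Reachable B T 0 0 0 0 :=
  ⟨0, fun _ => none, fun _ => false, fun _ => false, by simp, by simp, by simp, by simp, by simp,
    by simp, by simp⟩

theorem IsPlay.isStarForest {n : ℕ} {p : ℕ → Option ℕ} {q x : ℕ → Bool}
    (h : IsPlay B T a o m₀ m₁ n p q x) : IsStarForest T p := fun i j hij =>
  ⟨(h.leaf i j hij).1, (h.leaf i j hij).2.1, (h.leaf i j hij).2.2.2.1⟩

theorem IsPlay.eq_none {n i : ℕ} {p : ℕ → Option ℕ} {q x : ℕ → Bool}
    (h : IsPlay B T a o m₀ m₁ n p q x) (hi : n ≤ i) : p i = none := by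
  rcases hp : p i with _ | j
  · rfl
  · exact absurd (h.leaf i j hp).2.2.1 (by omega)

/-- Appending an isolated request with prediction `b`. -/
theorem IsPlay.append_isolated (hB : IsOnline B) {n : ℕ} {p : ℕ → Option ℕ} {q x : ℕ → Bool}
    (h : IsPlay B T a o m₀ m₁ n p q x) (b : Bool) :
    IsPlay B T (a + if B p (Function.update q n b) n = false then 1 else 0) (o + 1) m₀
      (m₁ + b.toNat) (n + 1) p (Function.update q n b) x := by
  have hq : ∀ i, i < n → Function.update q n b i = q i := fun i hi =>
    Function.update_of_ne hi.ne _ _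
  have hans : ∀ i, i < n → B p (Function.update q n b) i = B p q i := fun i hi =>
    hB i _ _ _ _ (fun _ _ => rfl) fun j hj => hq j (hj.trans_lt hi)
  have hxn := (h.beyond n le_rfl).2
  refine ⟨?_, ?_, ?_, ?_, ?_, ?_, ?_⟩
  · intro i hi
    rw [Function.update_of_ne (by omega)]
    exact h.beyond i (by omega)
  · intro i j hij
    obtain ⟨h1, h2, h3, h4, h5, h6, h7⟩ := h.leaf i j hij
    exact ⟨h1, h2, by omega, h4, h5, h6, by rw [hans j (by omega), h7]⟩
  · rw [Nat.count_succ, Nat.count_congr_of_lt (Q := fun i => p i = none ∧ B p q i = false)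
      (fun i hi => by rw [hans i hi])]
    have := h.accepted
    simp only [h.eq_none le_rfl, true_and]
    omega
  · rw [Nat.count_succ, if_pos hxn]
    exact Nat.add_le_add_right h.le_count 1
  · intro y hy
    have := h.optimal y fun i hi => hy i (by omega)
    rw [Nat.count_succ, Nat.count_succ, if_pos hxn]
    split_ifs <;> omega
  · rw [Nat.count_succ, Nat.count_congr_of_lt (Q := fun i => x i = true ∧ q i = false)
      (fun i hi => by rw [hq i hi]), if_neg (by simp [hxn])]
    exact h.error₀
  · rw [Nat.count_succ, Nat.count_congr_of_lt (Q := fun i => x i = false ∧ q i = true)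
      (fun i hi => by rw [hq i hi])]
    have := h.error₁
    cases b <;> simp [hxn, this]

/-- Appending a centre with prediction `b` that the player accepts, followed by its `T` leaves. -/
theorem IsPlay.append_star (hB : IsOnline B) (hT : 1 ≤ T) {n : ℕ} {p : ℕ → Option ℕ}
    {q x : ℕ → Bool} (h : IsPlay B T a o m₀ m₁ n p q x) (b : Bool)
    (hacc : B p (Function.update q n b) n = false) :
    IsPlay B T (a + 1) (o + T) (m₀ + (!b).toNat) m₁ (n + (1 + T))
      (fun i => if n < i ∧ i ≤ n + T then some n else p i) (Function.update q n b)
      (Function.update x n true) := by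
  set p' : ℕ → Option ℕ := fun i => if n < i ∧ i ≤ n + T then some n else p i with hp'
  have hp : ∀ i, i ≤ n → p' i = p i := fun i hi => if_neg (by omega)
  have hleaf : ∀ k < T, p' (n + (1 + k)) = some n := fun k hk => if_pos (by omega)
  have hq : ∀ i, i ≠ n → Function.update q n b i = q i := fun i hi =>
    Function.update_of_ne hi _ _
  have hx : ∀ i, i ≠ n → Function.update x n true i = x i := fun i hi =>
    Function.update_of_ne hi _ _
  have hans : ∀ i, i < n → B p' (Function.update q n b) i = B p q i := fun i hi =>
    hB i _ _ _ _ (fun j hj => hp j (by omega)) fun j hj => hq j (by omega)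
  -- The leaves come after position `n`, so attaching them cannot revoke the acceptance.
  have hansn : B p' (Function.update q n b) n = false := by
    rw [← hacc]
    exact hB n _ _ _ _ (fun j hj => hp j hj) fun _ _ => rfl
  -- The default values beyond `n` make every leaf a correctly predicted member of the optimum.
  have hx' : ∀ k, Function.update x n true (n + (1 + k)) = false := fun k => by
    rw [hx _ (by omega)]
    exact (h.beyond _ (by omega)).2
  have hq' : ∀ k, Function.update q n b (n + (1 + k)) = false := fun k => by
    rw [hq _ (by omega)]
    exact (h.beyond _ (by omega)).1
  have hcount : Nat.count (fun i => Function.update x n true i = false) (n + (1 + T)) =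
      Nat.count (fun i => x i = false) n + T := by
    rw [Nat.count_add_one_add True (Q := fun i => x i = false) (fun i hi => by rw [hx i hi.ne])
      (fun k _ => by simp only [hx'])]
    simp
  refine ⟨?_, ?_, ?_, ?_, ?_, ?_, ?_⟩
  · intro i hi
    rw [hq i (by omega), hx i (by omega)]
    exact h.beyond i (by omega)
  · intro i j hij
    by_cases hi : n < i ∧ i ≤ n + T
    · obtain rfl : n = j := by simpa [hp', hi] using hij
      refine ⟨hi.1, hi.2, by omega, by rw [hp n le_rfl, h.eq_none le_rfl], ?_, by simp, hansn⟩
      rw [hx i (by omega)]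
      exact (h.beyond i (by omega)).2
    · obtain ⟨h1, h2, h3, h4, h5, h6, h7⟩ := h.leaf i j (by simpa [hp', hi] using hij)
      exact ⟨h1, h2, by omega, by rw [hp j (by omega), h4], by rw [hx i (by omega), h5],
        by rw [hx j (by omega), h6], by rw [hans j (by omega), h7]⟩
  · rw [Nat.count_add_one_add False (Q := fun i => p i = none ∧ B p q i = false)
      (fun i hi => by rw [hans i hi, hp i hi.le]) (fun k hk => by simp [hleaf k hk])]
    have := h.accepted
    simp only [if_false]
    split_ifs <;> omega
  · rw [hcount]
    exact Nat.add_le_add_right h.le_count T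
  · intro y hy
    have hold := h.optimal y fun i hi j hij => hy i (by omega) j (by rw [hp i hi.le, hij])
    rw [hcount]
    -- A solution containing the new centre has none of its leaves and gains only `1 ≤ T`.
    by_cases hyn : y n = false
    · rw [Nat.count_add_one_add False (Q := fun i => y i = false) (fun _ _ => Iff.rfl)
        (fun k hk => by
          have := hy (n + (1 + k)) (by omega) n (hleaf k hk)
          simp_all)]
      simp only [if_false, if_pos hyn]
      omega
    · have := Nat.count_le (p := fun k => y (n + 1 + k) = false) (n := T)
      rw [← add_assoc, Nat.count_add, Nat.count_succ, if_neg hyn]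
      omega
  · rw [Nat.count_add_one_add False (Q := fun i => x i = true ∧ q i = false)
      (fun i hi => by rw [hq i hi.ne, hx i hi.ne]) (fun k _ => by simp only [hx']; simp)]
    have := h.error₀
    cases b <;> simp [this]
  · rw [Nat.count_add_one_add False (Q := fun i => x i = false ∧ q i = true)
      (fun i hi => by rw [hq i hi.ne, hx i hi.ne]) (fun k _ => by simp only [hq']; simp)]
    have := h.error₁
    simp [this]

/-- With prediction 0 an isolated request is error-free whatever the answer. This free unit of
optimum is why `T - 1` challenges suffice. -/
theorem Reachable.final (hB : IsOnline B) (h : Reachable B T a o m₀ m₁) :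
    Reachable B T (a + 1) (o + 1) m₀ m₁ := by
  obtain ⟨n, p, q, x, h⟩ := h
  have h' : Reachable B T _ _ _ _ := ⟨_, _, _, _, h.append_isolated hB false⟩
  exact h'.mono (by split_ifs <;> omega) le_rfl le_rfl (by simp)

theorem Reachable.challenge (hB : IsOnline B) (hT : 1 ≤ T) (h : Reachable B T a o m₀ m₁)
    (b : Bool) :
    Reachable B T a (o + 1) m₀ (m₁ + b.toNat) ∨
      Reachable B T (a + 1) (o + T) (m₀ + (!b).toNat) m₁ := by
  obtain ⟨n, p, q, x, h⟩ := h
  by_cases hacc : B p (Function.update q n b) n = false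
  · exact Or.inr ⟨_, _, _, _, h.append_star hB hT b hacc⟩
  · have := h.append_isolated hB b
    rw [if_neg hacc] at this
    exact Or.inl ⟨_, _, _, _, this⟩

/-- The adversary stops at the first acceptance. In that case the optimum gained from earlier
rejections is discarded, while their errors stay bounded by those of `k` rejections. -/
theorem Reachable.challenges (hB : IsOnline B) (hT : 1 ≤ T) (h : Reachable B T a o m₀ m₁)
    (b : Bool) (k : ℕ) :
    Reachable B T a (o + k) m₀ (m₁ + b.toNat * k) ∨
      Reachable B T (a + 1) (o + T) (m₀ + (!b).toNat) (m₁ + b.toNat * k) := by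
  induction k with
  | zero => exact Or.inl h
  | succ k ih =>
    rw [Nat.mul_succ, ← add_assoc, ← add_assoc]
    rcases ih with ih | ih
    · rcases ih.challenge hB hT b with h' | h'
      · exact Or.inl h'
      · exact Or.inr (h'.mono le_rfl (by omega) le_rfl (by omega))
    · exact Or.inr (ih.mono le_rfl le_rfl le_rfl (by omega))

theorem Reachable.round (hB : IsOnline B) (hT : 1 ≤ T) (h : Reachable B T a o m₀ m₁) (b : Bool) :
    Reachable B T (a + 1) (o + T) (m₀ + (!b).toNat) (m₁ + b.toNat * (T - 1)) := by
  rcases h.challenges hB hT b (T - 1) with h' | h'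
  · exact (h'.final hB).mono le_rfl (by omega) (by omega) le_rfl
  · exact h'

theorem reachable_rounds (hB : IsOnline B) (hT : 1 ≤ T) (b : Bool) (M : ℕ) :
    Reachable B T M (T * M) ((!b).toNat * M) (b.toNat * (T - 1) * M) := by
  induction M with
  | zero => exact reachable_zero
  | succ M ih => exact ih.round hB hT b

end Play

/-! ### Star forests as request sequences of the four problems -/

/-- `enc` turns star forests into valid request sequences of `P` whose feasible solutions are the
sets of positions that contain no centre together with one of its leaves. -/
def EncodesStarForests (P : OnlineMaxProblem) (T : ℕ) (enc : ℕ → Option ℕ → P.Request) : Prop :=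
  ∀ p, IsStarForest T p → ∀ n : ℕ,
    P.Valid (fun i : Fin n => enc i (p i)) ∧
    ∀ S : Set (Fin n), P.Feasible (fun i : Fin n => enc i (p i)) S ↔
      ∀ i ∈ S, ∀ j ∈ S, p i ≠ some (j : ℕ)

/-- Star forests have maximum degree at most `T`. -/
theorem IsStarForest.encard_le {T : ℕ} (hT : 1 ≤ T) {p : ℕ → Option ℕ} (hp : IsStarForest T p)
    {n : ℕ} (i : Fin n) : {j : Fin n | p i = some (j : ℕ) ∨ p j = some (i : ℕ)}.encard ≤ T := by
  rcases hpi : p i with _ | k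
  · have hsub : (fun j : Fin n => (j : ℕ)) '' {j : Fin n | none = some (j : ℕ) ∨ p j = some (i : ℕ)}
        ⊆ (Finset.Ioc (i : ℕ) (i + T) : Set ℕ) := by
      rintro _ ⟨j, hj, rfl⟩
      simp only [reduceCtorEq, false_or, Set.mem_ofPred_eq] at hj
      have := hp _ _ hj
      simp only [Finset.coe_Ioc, Set.mem_Ioc]
      omega
    have := Set.encard_le_encard hsub
    rw [Fin.val_injective.encard_image, Set.encard_coe_eq_coe_finsetCard] at this
    simpa using this
  -- A leaf has no leaves of its own, so its only neighbour is its centre.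
  · refine le_trans (Set.encard_le_one_iff.2 fun a b ha hb => ?_) (by exact_mod_cast hT)
    have key : ∀ c : Fin n, (some k = some (c : ℕ) ∨ p c = some (i : ℕ)) → k = c := by
      rintro c (hc | hc)
      · simpa using hc
      · have := (hp _ _ hc).2.2
        simp [hpi] at this
    exact Fin.ext ((key a ha).symm.trans (key b hb))

section Encodings

variable {t : ℕ∞} {T : ℕ}

/-- Vertices are named by their positions. -/
def bdisEnc (i : ℕ) (o : Option ℕ) : VertexRequest := ⟨i, o.toFinset⟩

theorem arrivalGraph_bdisEnc_adj {p : ℕ → Option ℕ} (hp : IsStarForest T p) {n : ℕ}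
    (i j : Fin n) : (arrivalGraph fun i : Fin n => bdisEnc i (p i)).Adj i j ↔
      p i = some (j : ℕ) ∨ p j = some (i : ℕ) := by
  simp only [arrivalGraph, SimpleGraph.fromRel_adj, bdisEnc, Option.mem_toFinset, Option.mem_def]
  refine ⟨fun h => h.2.symm, fun h => ⟨?_, h.symm⟩⟩
  rintro rfl
  have := (hp i i (by tauto)).1
  omega

theorem bdis_encodes (hT : 1 ≤ T) (hTt : (T : ℕ∞) ≤ t) :
    EncodesStarForests (BDIS t) T bdisEnc := by
  intro p hp n
  refine ⟨⟨⟨fun i j h => Fin.ext h, ?_⟩, fun i => ?_⟩, fun S => ?_⟩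
  · intro j v hv
    have hv' : p j = some v := by simpa [bdisEnc] using hv
    have := (hp _ _ hv').1
    exact ⟨⟨v, this.trans j.2⟩, this, rfl⟩
  · refine le_trans (le_of_eq ?_) ((hp.encard_le hT i).trans hTt)
    congr 1
    ext j
    exact arrivalGraph_bdisEnc_adj hp i j
  · change (arrivalGraph fun i : Fin n => bdisEnc i (p i)).IsIndepSet S ↔ _
    constructor
    · intro h i hi j hj hij
      have hadj := (arrivalGraph_bdisEnc_adj hp i j).2 (Or.inl hij)
      exact h hi hj hadj.ne hadj
    · intro h i hi j hj _ hadj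
      rcases (arrivalGraph_bdisEnc_adj hp i j).1 hadj with h' | h'
      · exact h i hi j hj h'
      · exact h j hj i hi h'

/-- Vertices are named by their positions, and the parent is the only earlier non-neighbour. -/
def cliEnc (i : ℕ) (o : Option ℕ) : VertexRequest := ⟨i, Finset.range i \ o.toFinset⟩

theorem arrivalGraph_cliEnc_adj {p : ℕ → Option ℕ} (hp : IsStarForest T p) {n : ℕ}
    (i j : Fin n) : (arrivalGraph fun i : Fin n => cliEnc i (p i)).Adj i j ↔
      i ≠ j ∧ ¬ (p i = some (j : ℕ) ∨ p j = some (i : ℕ)) := by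
  simp only [arrivalGraph, SimpleGraph.fromRel_adj, cliEnc, Finset.mem_sdiff, Finset.mem_range,
    Option.mem_toFinset, Option.mem_def]
  refine and_congr_right fun hij => ?_
  have h1 : (i : ℕ) ≠ j := fun h => hij (Fin.ext h)
  have h2 : p i = some (j : ℕ) → (j : ℕ) < i := fun h => (hp _ _ h).1
  have h3 : p j = some (i : ℕ) → (i : ℕ) < j := fun h => (hp _ _ h).1
  by_cases hi : p i = some (j : ℕ) <;> by_cases hj : p j = some (i : ℕ) <;>
    simp only [hi, hj, true_implies] at h2 h3 ⊢ <;> simp <;> omega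

theorem cli_encodes (hT : 1 ≤ T) (hTt : (T : ℕ∞) ≤ t) :
    EncodesStarForests (Cli t) T cliEnc := by
  intro p hp n
  refine ⟨⟨⟨fun i j h => Fin.ext h, ?_⟩, fun i => ?_⟩, fun S => ?_⟩
  · intro j v hv
    have hv' : v < j := by
      simp only [cliEnc, Finset.mem_sdiff, Finset.mem_range] at hv
      exact hv.1
    exact ⟨⟨v, hv'.trans j.2⟩, hv', rfl⟩
  · set N := (arrivalGraph fun i : Fin n => cliEnc i (p i)).neighborSet i with hN
    have hsub : (Set.univ : Set (Fin n)) ⊆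
        N ∪ {j : Fin n | p i = some (j : ℕ) ∨ p j = some (i : ℕ)} ∪ {i} := by
      intro j _
      have : j ∈ N ↔ _ := arrivalGraph_cliEnc_adj hp i j
      simp only [Set.mem_union, this, Set.mem_ofPred_eq, Set.mem_singleton_iff]
      tauto
    calc (n : ℕ∞) = (Set.univ : Set (Fin n)).encard := by simp
      _ ≤ _ := Set.encard_le_encard hsub
      _ ≤ _ := Set.encard_union_le _ _
      _ ≤ N.encard + t + 1 := by
        gcongr
        · exact (Set.encard_union_le _ _).trans
            (add_le_add le_rfl ((hp.encard_le hT i).trans hTt))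
        · simp
  · change (arrivalGraph fun i : Fin n => cliEnc i (p i)).IsClique S ↔ _
    constructor
    · intro h i hi j hj hij
      have hne : i ≠ j := by
        rintro rfl
        have := (hp i i hij).1
        omega
      exact ((arrivalGraph_cliEnc_adj hp i j).1 (h hi hj hne)).2 (Or.inl hij)
    · intro h i hi j hj hij
      exact (arrivalGraph_cliEnc_adj hp i j).2
        ⟨hij, by rintro (h' | h'); exacts [h i hi j hj h', h j hj i hi h']⟩

/-- The conflicts of a symmetric relation that relates every position exactly to its parent among
the earlier ones. -/
theorem intersects_iff_of_lt {p : ℕ → Option ℕ} {R : ℕ → ℕ → Prop} (hR : ∀ i j, R i j ↔ R j i)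
    (h : ∀ i j, j < i → (R i j ↔ p i = some j)) (hp : IsStarForest T p) {i j : ℕ} (hij : i ≠ j) :
    R i j ↔ p i = some j ∨ p j = some i := by
  have h2 : p i = some j → j < i := fun h => (hp _ _ h).1
  have h3 : p j = some i → i < j := fun h => (hp _ _ h).1
  rcases lt_or_gt_of_ne hij with hlt | hlt
  · rw [hR, h _ _ hlt]
    exact ⟨Or.inr, fun h => h.resolve_left fun h => absurd (h2 h) (by omega)⟩
  · rw [h _ _ hlt]
    exact ⟨Or.inl, fun h => h.resolve_right fun h => absurd (h3 h) (by omega)⟩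

theorem encard_intersects_le {p : ℕ → Option ℕ} {R : ℕ → ℕ → Prop} (hR : ∀ i j, R i j ↔ R j i)
    (h : ∀ i j, j < i → (R i j ↔ p i = some j)) (hp : IsStarForest T p) (hT : 1 ≤ T)
    (hTt : (T : ℕ∞) ≤ t) {n : ℕ} (i : Fin n) :
    {j : Fin n | j ≠ i ∧ R i j}.encard ≤ t := by
  refine (Set.encard_le_encard fun j hj => ?_).trans ((hp.encard_le hT i).trans hTt)
  exact (intersects_iff_of_lt hR h hp fun h' => hj.1 (Fin.ext h'.symm)).1 hj.2

theorem pairwise_not_intersects_iff {p : ℕ → Option ℕ} {R : ℕ → ℕ → Prop}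
    (hR : ∀ i j, R i j ↔ R j i) (h : ∀ i j, j < i → (R i j ↔ p i = some j))
    (hp : IsStarForest T p) {n : ℕ} (S : Set (Fin n)) :
    (∀ i ∈ S, ∀ j ∈ S, i ≠ j → ¬ R i j) ↔ ∀ i ∈ S, ∀ j ∈ S, p i ≠ some (j : ℕ) := by
  constructor
  · intro hS i hi j hj hij
    have hlt := (hp _ _ hij).1
    exact hS i hi j hj (fun h' => by subst h'; omega) ((h i j hlt).2 hij)
  · intro hS i hi j hj hij hRij
    rcases (intersects_iff_of_lt hR h hp fun h' => hij (Fin.ext h')).1 hRij with h' | h'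
    · exact hS i hi j hj h'
    · exact hS j hj i hi h'

/-- The leaf at position `i` with centre `j` is the singleton of the pair `(j, i)`, and a centre is
the union of all its possible leaves. -/
def spEnc (T i : ℕ) : Option ℕ → Finset ℕ
  | none => (Finset.Ioc i (i + T)).image (Nat.pair i)
  | some j => {Nat.pair j i}

/-- The first coordinate of a pair identifies the centre and the second the leaf. A centre holds
only pairs with second coordinate beyond its own position, so it misses all earlier leaves. -/
theorem spEnc_intersects {p : ℕ → Option ℕ} (hp : IsStarForest T p) (i j : ℕ) (hij : j < i) :
    (spEnc T i (p i) ∩ spEnc T j (p j)).Nonempty ↔ p i = some j := by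
  constructor
  · rintro ⟨a, ha⟩
    rw [Finset.mem_inter] at ha
    rcases hi : p i with _ | k <;> rcases hj : p j with _ | l <;>
      simp only [hi, hj, spEnc, Finset.mem_image, Finset.mem_singleton] at ha
    · obtain ⟨⟨b, _, rfl⟩, c, _, h⟩ := ha
      exact absurd (Nat.pair_eq_pair.1 h).1 (by omega)
    · obtain ⟨⟨b, hb, rfl⟩, h⟩ := ha
      have := (Nat.pair_eq_pair.1 h).2
      simp only [Finset.mem_Ioc] at hb
      omega
    · obtain ⟨rfl, c, _, h⟩ := ha
      rw [(Nat.pair_eq_pair.1 h).1]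
    · obtain ⟨rfl, h⟩ := ha
      exact absurd (Nat.pair_eq_pair.1 h).2 (by omega)
  · intro h
    obtain ⟨h1, h2, h3⟩ := hp _ _ h
    refine ⟨Nat.pair j i, ?_⟩
    simp only [h, h3, spEnc, Finset.mem_inter, Finset.mem_singleton, Finset.mem_image,
      Finset.mem_Ioc, true_and]
    exact ⟨i, ⟨h1, h2⟩, rfl⟩

theorem sp_encodes (hT : 1 ≤ T) (hTt : (T : ℕ∞) ≤ t) :
    EncodesStarForests (SP t) T (spEnc T) := by
  intro p hp n
  have hR : ∀ i j, (spEnc T i (p i) ∩ spEnc T j (p j)).Nonempty ↔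
      (spEnc T j (p j) ∩ spEnc T i (p i)).Nonempty := fun i j => by rw [Finset.inter_comm]
  refine ⟨fun i => encard_intersects_le hR (spEnc_intersects hp) hp hT hTt i, fun S => ?_⟩
  rw [← pairwise_not_intersects_iff hR (spEnc_intersects hp) hp S]
  change (∀ i ∈ S, ∀ j ∈ S, i ≠ j → Disjoint (spEnc T i (p i)) (spEnc T j (p j))) ↔ _
  simp only [Finset.not_nonempty_iff_eq_empty, Finset.disjoint_iff_inter_eq_empty]

/-- Centre `i` is the unit interval `(i, i + 1)`; the leaf at position `i` with centre `j` is one of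
the `T` pieces of equal length of the interval of `j`. -/
noncomputable def schEnc (hT : 1 ≤ T) (i : ℕ) : Option ℕ → OpenInterval
  | none => ⟨i, i + 1, by simp⟩
  | some j => ⟨j + ((i : ℝ) - j - 1) / T, j + ((i : ℝ) - j) / T, by
      have : (0 : ℝ) < T := by exact_mod_cast hT
      exact add_lt_add_right ((div_lt_div_iff_of_pos_right this).2 (by linarith)) _⟩

theorem OpenInterval.inter_nonempty_iff (u v : OpenInterval) :
    (u.toSet ∩ v.toSet).Nonempty ↔ u.left < v.right ∧ v.left < u.right := by
  rw [toSet, toSet, Set.Ioo_inter_Ioo, Set.nonempty_Ioo]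
  have := u.left_lt_right
  have := v.left_lt_right
  simp only [sup_lt_iff, lt_inf_iff]
  tauto

/-- A request lies in the unit interval of its centre. -/
theorem schEnc_bounds (hT : 1 ≤ T) {p : ℕ → Option ℕ} (hp : IsStarForest T p) (i : ℕ) :
    (((p i).getD i : ℕ) : ℝ) ≤ (schEnc hT i (p i)).left ∧
      (schEnc hT i (p i)).right ≤ (((p i).getD i : ℕ) : ℝ) + 1 := by
  have hT' : (0 : ℝ) < T := by exact_mod_cast hT
  rcases hi : p i with _ | k
  · simp [schEnc]
  · obtain ⟨h1, h2, -⟩ := hp _ _ hi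
    have h1' : (k : ℝ) + 1 ≤ i := by exact_mod_cast h1
    have h2' : (i : ℝ) ≤ k + T := by exact_mod_cast h2
    simp only [schEnc, Option.getD_some]
    refine ⟨?_, ?_⟩
    · have : 0 ≤ ((i : ℝ) - k - 1) / T := div_nonneg (by linarith) hT'.le
      linarith
    · have : ((i : ℝ) - k) / T ≤ 1 := (div_le_one hT').2 (by linarith)
      linarith

/-- Each request stays inside the unit interval of its centre, so an overlap forces a common centre;
distinct leaves of one centre are disjoint pieces. -/
theorem schEnc_intersects (hT : 1 ≤ T) {p : ℕ → Option ℕ} (hp : IsStarForest T p) (i j : ℕ)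
    (hij : j < i) :
    ((schEnc hT i (p i)).toSet ∩ (schEnc hT j (p j)).toSet).Nonempty ↔ p i = some j := by
  have hT' : (0 : ℝ) < T := by exact_mod_cast hT
  have hbi := schEnc_bounds hT hp i
  have hbj := schEnc_bounds hT hp j
  rw [OpenInterval.inter_nonempty_iff]
  constructor
  · rintro ⟨h1, h2⟩
    have heq : (p i).getD i = (p j).getD j := by
      have e1 : (((p i).getD i : ℕ) : ℝ) < ((p j).getD j : ℕ) + 1 := by linarith
      have e2 : (((p j).getD j : ℕ) : ℝ) < ((p i).getD i : ℕ) + 1 := by linarith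
      norm_cast at e1 e2
      omega
    rcases hi : p i with _ | k <;> rcases hj : p j with _ | l <;>
      simp only [hi, hj, Option.getD_none, Option.getD_some] at heq
    · omega
    · have := (hp _ _ hj).1
      omega
    · rw [heq]
    · subst heq
      simp only [hi, hj, schEnc] at h1
      have h3 : ((i : ℝ) - k - 1) / T < ((j : ℝ) - k) / T := by linarith
      have h4 := (div_lt_div_iff_of_pos_right hT').1 h3
      have h5 : (j : ℝ) + 1 ≤ i := by exact_mod_cast hij
      linarith
  · intro h
    obtain ⟨-, -, h3⟩ := hp _ _ h
    have hu := (schEnc hT i (p i)).left_lt_right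
    simp only [h, h3, Option.getD_some, schEnc] at hbi hbj hu ⊢
    constructor <;> linarith

theorem sch_encodes (hT : 1 ≤ T) (hTt : (T : ℕ∞) ≤ t) :
    EncodesStarForests (Sch t) T (schEnc hT) := by
  intro p hp n
  have hR : ∀ i j, ((schEnc hT i (p i)).toSet ∩ (schEnc hT j (p j)).toSet).Nonempty ↔
      ((schEnc hT j (p j)).toSet ∩ (schEnc hT i (p i)).toSet).Nonempty :=
    fun i j => by rw [Set.inter_comm]
  exact ⟨fun i => encard_intersects_le hR (schEnc_intersects hT hp) hp hT hTt i,
    fun S => pairwise_not_intersects_iff hR (schEnc_intersects hT hp) hp S⟩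

theorem exists_encoding {P : OnlineMaxProblem}
    (hP : P ∈ ({BDIS t, Sch t, SP t, Cli t} : Set OnlineMaxProblem)) (hT : 1 ≤ T)
    (hTt : (T : ℕ∞) ≤ t) : ∃ enc, EncodesStarForests P T enc := by
  rcases hP with rfl | rfl | rfl | rfl
  exacts [⟨_, bdis_encodes hT hTt⟩, ⟨_, sch_encodes hT hTt⟩, ⟨_, sp_encodes hT hTt⟩,
    ⟨_, cli_encodes hT hTt⟩]

end Encodings

/-! ### From plays to instances and competitive ratios -/

section Instances

variable {P : OnlineMaxProblem} {T : ℕ}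

theorem sum_fin_indicator {K : Type*} [Semiring K] (Q : ℕ → Prop) [DecidablePred Q] (n : ℕ)
    (f : Fin n → K) (hf : ∀ i : Fin n, f i = if Q i then 1 else 0) :
    ∑ i, f i = Nat.count Q n := by
  rw [Finset.sum_congr rfl fun i _ => hf i,
    Fin.sum_univ_eq_sum_range (fun i => if Q i then (1 : K) else 0), Finset.sum_boole,
    Nat.count_eq_card_filter_range]

theorem sum_one_sub_toNat (y : ℕ → Bool) (n : ℕ) :
    (∑ i : Fin n, (1 - ((y i).toNat : ℝ))) = Nat.count (fun i => y i = false) n :=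
  sum_fin_indicator _ n _ fun i => by cases y i <;> simp

/-- The profit of a string on the request sequence of a star forest. -/
theorem EncodesStarForests.profit_eq {enc : ℕ → Option ℕ → P.Request}
    (henc : EncodesStarForests P T enc) {p : ℕ → Option ℕ} (hp : IsStarForest T p) (n : ℕ)
    (y : ℕ → Bool) :
    P.profit (fun i : Fin n => enc i (p i)) (fun i => y i) =
      open Classical in
      if ∀ i < n, ∀ j, p i = some j → y i = false → y j = true then
        (((Nat.count (fun i => y i = false) n : ℕ) : ℝ) : EReal) else ⊥ := by
  classical
  rw [OnlineMaxProblem.profit, sum_one_sub_toNat y n]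
  refine if_congr (((henc p hp n).2 _).trans ⟨fun h i hi j hij hyi => ?_, ?_⟩) rfl rfl
  · have hj : j < n := (hp i j hij).1.trans hi
    by_contra hyj
    exact h ⟨i, hi⟩ hyi ⟨j, hj⟩ (by simpa using hyj) hij
  · intro h i hi j hj hij
    have h1 : y i = false := hi
    have h2 : y j = false := hj
    simpa [h2] using h i i.2 j hij h1

/-- The answers of an algorithm, as a function of the parents and the predictions. -/
def OnlineMaxProblem.Algorithm.answer (A : P.Algorithm) (enc : ℕ → Option ℕ → P.Request)
    (p : ℕ → Option ℕ) (q : ℕ → Bool) (i : ℕ) : Bool :=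
  A i fun j : Fin (i + 1) => (enc j (p j), q j)

theorem OnlineMaxProblem.Algorithm.isOnline_answer (A : P.Algorithm)
    (enc : ℕ → Option ℕ → P.Request) : IsOnline (A.answer enc) := by
  intro i p p' q q' hp hq
  simp only [answer]
  congr 1
  funext j
  rw [hp j (Nat.lt_succ_iff.1 j.2), hq j (Nat.lt_succ_iff.1 j.2)]

/-- Every leaf has an accepted centre, so accepting a leaf yields profit `⊥`. Counting accepted
parentless requests therefore bounds the profit. -/
theorem OnlineMaxProblem.Algorithm.exists_hard_instance (A : P.Algorithm)
    {enc : ℕ → Option ℕ → P.Request} (henc : EncodesStarForests P T enc) {a o m₀ m₁ : ℕ}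
    (h : Reachable (A.answer enc) T a o m₀ m₁) :
    ∃ I : P.Instance, ((o : ℝ) : EReal) ≤ I.opt ∧ A.profit I ≤ ((a : ℝ) : EReal) ∧
      mu0 I ≤ m₀ ∧ mu1 I ≤ m₁ := by
  obtain ⟨n, p, q, x, h⟩ := h
  have hp := h.isStarForest
  have hx : P.profit (fun i : Fin n => enc i (p i)) (fun i => x i) =
      (((Nat.count (fun i => x i = false) n : ℕ) : ℝ) : EReal) := by
    rw [henc.profit_eq hp, if_pos fun i _ j hij _ => (h.leaf i j hij).2.2.2.2.2.1]
  have hopt : P.profit (fun i : Fin n => enc i (p i)) (fun i => x i) =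
      P.optProfit (fun i : Fin n => enc i (p i)) := by
    refine le_antisymm (le_iSup (fun y => P.profit (fun i : Fin n => enc i (p i)) y) _)
      (iSup_le fun y => ?_)
    obtain ⟨z, rfl⟩ : ∃ z : ℕ → Bool, y = fun i : Fin n => z i :=
      -- The default is immaterial: only positions below `n` are read.
      ⟨fun i => if hi : i < n then y ⟨i, hi⟩ else true, by ext i; simp⟩
    rw [hx, henc.profit_eq hp]
    split_ifs with hz
    · exact_mod_cast h.optimal z hz
    · exact bot_le
  let I : P.Instance :=
    ⟨n, fun i => x i, fun i => q i, fun i => enc i (p i), (henc p hp n).1, hopt⟩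
  refine ⟨I, ?_, ?_, ?_, ?_⟩
  · change _ ≤ P.optProfit fun i : Fin n => enc i (p i)
    rw [← hopt, hx]
    exact_mod_cast h.le_count
  · change P.profit (fun i : Fin n => enc i (p i)) (fun i => A.answer enc p q i) ≤ _
    rw [henc.profit_eq hp]
    split_ifs with hz
    · rw [Nat.count_congr_of_lt (Q := fun i => p i = none ∧ A.answer enc p q i = false)]
      · exact_mod_cast h.accepted
      · intro i hi
        refine ⟨fun hi' => ⟨?_, hi'⟩, And.right⟩
        rcases hpi : p i with _ | j
        · rfl
        · have h1 := hz i hi j hpi hi'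
          rw [(h.leaf i j hpi).2.2.2.2.2.2] at h1
          cases h1
    · exact bot_le
  · have : mu0 I = (Nat.count (fun i => x i = true ∧ q i = false) n : ℕ) :=
      sum_fin_indicator _ n _ fun i => by
        change ((x i).toNat : ℝ≥0) * (1 - ((q i).toNat : ℝ≥0)) = _
        cases x i <;> cases q i <;> simp
    rw [this]
    exact_mod_cast h.error₀
  · have : mu1 I = (Nat.count (fun i => x i = false ∧ q i = true) n : ℕ) :=
      sum_fin_indicator _ n _ fun i => by
        change (1 - ((x i).toNat : ℝ≥0)) * ((q i).toNat : ℝ≥0) = _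
        cases x i <;> cases q i <;> simp
    rw [this]
    exact_mod_cast h.error₁

/-- The trade-off between the parameters, for predictions `b` on the challenge requests. -/
theorem OnlineMaxProblem.Algorithm.IsCompetitive.natCast_le_iSup {A : P.Algorithm}
    {α β γ : P.Instance → ℝ≥0} (hA : A.IsCompetitive α β γ mu0 mu1)
    {enc : ℕ → Option ℕ → P.Request} (henc : EncodesStarForests P T enc) (hT : 1 ≤ T) (b : Bool) :
    (T : ℝ≥0∞) ≤ ⨆ I, ((α I : ℝ≥0∞) + ((!b).toNat : ℝ≥0∞) * (β I : ℝ≥0∞)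
      + ((b.toNat * (T - 1) : ℕ) : ℝ≥0∞) * (γ I : ℝ≥0∞)) := by
  by_contra! hlt
  obtain ⟨s, hs⟩ : ∃ s : ℝ≥0, (s : ℝ≥0∞) = _ := ⟨_, ENNReal.coe_toNNReal hlt.ne_top⟩
  obtain ⟨κ, hκ⟩ := hA
  rw [← hs] at hlt
  have hsT : (s : ℝ) < T := by
    have : s < (T : ℝ≥0) := by exact_mod_cast hlt
    exact_mod_cast this
  -- Enough rounds for the accumulated gap `M * (T - s)` to exceed `κ`.
  obtain ⟨M, hM⟩ := exists_nat_gt (κ / (T - s))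
  rw [div_lt_iff₀ (by linarith)] at hM
  obtain ⟨I, h1, h2, h3, h4⟩ :=
    A.exists_hard_instance henc (reachable_rounds (A.isOnline_answer enc) hT b M)
  have hI : (α I : ℝ) + ((!b).toNat : ℝ) * β I + ((b.toNat * (T - 1) : ℕ) : ℝ) * γ I ≤ s := by
    have := le_iSup (fun I => ((α I : ℝ≥0∞) + ((!b).toNat : ℝ≥0∞) * (β I : ℝ≥0∞)
      + ((b.toNat * (T - 1) : ℕ) : ℝ≥0∞) * (γ I : ℝ≥0∞))) I
    rw [← hs] at this
    have : α I + ((!b).toNat : ℝ≥0) * β I + ((b.toNat * (T - 1) : ℕ) : ℝ≥0) * γ I ≤ s := by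
      exact_mod_cast this
    exact_mod_cast this
  have h5 : (α I : EReal) * A.profit I ≤ ((α I * M : ℝ) : EReal) := by
    rw [EReal.coe_mul]
    exact mul_le_mul_of_nonneg_left h2 (by exact_mod_cast (α I).2)
  have h6 := (h1.trans (hκ I)).trans (add_le_add_left h5 _)
  rw [← EReal.coe_add, EReal.coe_le_coe_iff] at h6
  have h3' : (mu0 I : ℝ) ≤ ((!b).toNat * M : ℕ) := by exact_mod_cast h3
  have h4' : (mu1 I : ℝ) ≤ (b.toNat * (T - 1) * M : ℕ) := by exact_mod_cast h4
  have h7 := mul_le_mul_of_nonneg_left h3' (β I).2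
  have h8 := mul_le_mul_of_nonneg_left h4' (γ I).2
  have h9 := mul_le_mul_of_nonneg_right hI (Nat.cast_nonneg (α := ℝ) M)
  rw [Nat.cast_mul] at h6 h7 h8
  simp only [NNReal.val_eq_coe] at h7 h8
  nlinarith

end Instances

/-! ### From finite stars to arbitrary `t` -/

theorem ENat.toENNReal_le_of_forall_nat_le {t : ℕ∞} (ht : 1 ≤ t) {s : ℝ≥0∞}
    (h : ∀ T : ℕ, 1 ≤ T → (T : ℕ∞) ≤ t → (T : ℝ≥0∞) ≤ s) : (t : ℝ≥0∞) ≤ s := by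
  induction t with
  | top =>
    rw [ENat.toENNReal_top, top_le_iff]
    refine ENNReal.eq_top_of_forall_nnreal_le fun r => ?_
    obtain ⟨T, hT⟩ := exists_nat_ge r
    calc (r : ℝ≥0∞) ≤ ((T + 1 : ℕ) : ℝ≥0∞) := by
          exact_mod_cast hT.trans (by exact_mod_cast Nat.le_succ T)
      _ ≤ s := h _ (by omega) le_top
  | coe n => simpa using h n (by exact_mod_cast ht) le_rfl

theorem mainTheorem9 (t : ℕ∞) (ht : 1 ≤ t) (P : OnlineMaxProblem)
    (hP : P ∈ ({BDIS t, Sch t, SP t, Cli t} : Set OnlineMaxProblem))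
    (A : P.Algorithm) (α β γ : P.Instance → ℝ≥0)
    (hA : A.IsCompetitive α β γ OnlineMaxProblem.mu0 OnlineMaxProblem.mu1) :
    ((t : ℝ≥0∞) ≤ ⨆ I, ((α I : ℝ≥0∞) + (β I : ℝ≥0∞))) ∧
    ((t : ℝ≥0∞) ≤ ⨆ I, ((α I : ℝ≥0∞) + ((t : ℝ≥0∞) - 1) * (γ I : ℝ≥0∞))) ∧
    ((∀ I, β I = 0) → (∀ I, γ I = 0) → (t : ℝ≥0∞) ≤ ⨆ I, (α I : ℝ≥0∞)) := by
  have h₀ : (t : ℝ≥0∞) ≤ ⨆ I, ((α I : ℝ≥0∞) + (β I : ℝ≥0∞)) := by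
    refine ENat.toENNReal_le_of_forall_nat_le ht fun T hT hTt => ?_
    obtain ⟨enc, henc⟩ := exists_encoding hP hT hTt
    -- Predicting 0 on the challenges removes the `γ` term.
    simpa using hA.natCast_le_iSup henc hT false
  refine ⟨h₀, ENat.toENNReal_le_of_forall_nat_le ht fun T hT hTt => ?_, fun hβ _ => ?_⟩
  · obtain ⟨enc, henc⟩ := exists_encoding hP hT hTt
    -- Predicting 1 removes the `β` term; the coefficient `T - 1` is then enlarged to `t - 1`.
    refine (hA.natCast_le_iSup henc hT true).trans (iSup_mono fun I => ?_)
    have hle : (T : ℝ≥0∞) ≤ t := by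
      rw [← ENat.toENNReal_coe]
      exact ENat.toENNReal_mono hTt
    simp only [Bool.not_true, Bool.toNat_false, Nat.cast_zero, zero_mul, add_zero, Bool.toNat_true,
      one_mul, ENNReal.natCast_sub, Nat.cast_one]
    gcongr
  · simpa [hβ] using h₀
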